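/- Let $F$ be an algebraically closed field of characteristic zero and let $G$ be a group (finite or not, not necessarily abelian). For a tuple $\bar g=(g_1,\dots,g_n)\in G^n$ put $\mathrm{Sym}(\bar g)=\{\sigma\in S_n : g_1\cdots g_n=g_{\sigma(1)}\cdots g_{\sigma(n)}\}$ and $\bar g^{\sigma}=(g_{\sigma(1)},\dots,g_{\sigma(n)})$. A **$G$-commutation function** is a function $\theta$ assigning to every pair $(\bar g,\sigma)$ with $\bar g\in G^n$, $\sigma\in \mathrm{Sym}(\bar g)$ a scalar $\theta_{(\bar g,\sigma)}\in F^\times$ such that 1. if $1\le i\le j\le n$, and $\sigma\in \mathrm{Sym}(\bar g)$ fixes all $k<i$ and all $k>j$, then $\theta_{(\bar g,\sigma)}=\theta_{((g_i,\dots,g_j),\tilde\sigma)}$, where $\tilde\sigma$ is the restriction of $\sigma$ to $\{i,\dots,j\}$; 2. if $\bar h=(h_1,\dots,h_k)\in G^k$, $\bar g_i\in G^{n_i}$ ($n_i\ge 1$) is a tuple with product $h_i$ for each $i$, $\bar g=(\bar g_1,\dots,\bar g_k)$ is the concatenation, $\sigma\in \mathrm{Sym}(\bar h)$, and $\tilde\sigma$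 is the permutation that moves the blocks of sizes $n_1,\dots,n_k$ rigidly according to $\sigma$, so that $\bar g^{\tilde\sigma}=(\bar g_{\sigma(1)},\dots,\bar g_{\sigma(k)})$, then $\theta_{(\bar h,\sigma)}=\theta_{(\bar g,\tilde\sigma)}$; 3. $\theta_{(\bar g,\sigma)}\,\theta_{(\bar g^{\sigma},\tau)}=\theta_{(\bar g,\sigma\tau)}$ whenever $\sigma\in \mathrm{Sym}(\bar g)$ and $\tau\in \mathrm{Sym}(\bar g^{\sigma})$. For commuting $g,h\in G$ write $\theta_{g,h}=\theta_{((g,h),(1\,2))}$. A grading $A=\bigoplus_{g\in G}A_g$ of an associative unital $F$-algebra (with $A_gA_h\subseteq A_{gh}$) is **regular with commutation function $\theta$** if (a) $a_1\cdots a_n=\theta_{(\bar g,\sigma)}\,a_{\sigma(1)}\cdots a_{\sigma(n)}$ for all $\bar g\in G^n$, $\sigma\in \mathrm{Sym}(\bar g)$ and $a_i\in A_{g_i}$; and (b) for every $\bar g\in G^n$ there are $a_i\in A_{g_i}$ with $a_1\cdots a_n\ne 0$. Let $E=E_1\oplus E_{-1}$ be the infinite-dimensional Grassmann algebra over $F$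 on generators $e_i$ ($i\in\mathbb N$), where $E_1$ (resp. $E_{-1}$) is spanned by the products of an even (resp. odd) number of generators. For a $2$-cocycle $\alpha\in Z^2(G,F^\times)$ (trivial action), let $F^\alpha G=\bigoplus_{g\in G}F\,U_g$ be the twisted group algebra, with $U_gU_h=\alpha(g,h)U_{gh}$. **Lemma.** Let $\theta$ be a $G$-commutation function. Then $g\mapsto\theta_{g,g}$ is a homomorphism $G\to\{\pm1\}$. Let $H=\{g\in G:\theta_{g,g}=1\}$ be its kernel. There is a $2$-cocycle $\alpha\in Z^2(G,F^\times)$ such that, for $B=F^\alpha G$, $B_g=F\,U_g$, $B_1=\bigoplus_{h\in H}B_h$ and $B_{-1}=\bigoplus_{g\notin H}B_g$, the Grassmann envelope $\tilde B=(B_1\otimes E_1)\oplus(B_{-1}\otimes E_{-1})\subseteq B\otimes_F E$, with the $G$-grading $\tilde B_g=B_g\otimes E_1$ for $g\in H$ and $\tilde B_g=B_g\otimes E_{-1}$ for $g\notin H$, is regularly $G$-graded with commutation function $\theta$. -/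

import Mathlib

open scoped TensorProduct

noncomputable section

namespace RegularGrading

/-! ### Tuples, permutations and commutation functions -/

/-- `Sym(ḡ)` for a tuple `ḡ = (g₁, …, gₙ)`: the permutations `σ` such that
`g₁ ⋯ gₙ = g_{σ(1)} ⋯ g_{σ(n)}`. -/
def permSym {G : Type*} [Group G] {n : ℕ} (g : Fin n → G) : Set (Equiv.Perm (Fin n)) :=
  {σ | (List.ofFn g).prod = (List.ofFn (g ∘ σ)).prod}

/-- Functions `(ḡ, σ) ↦ θ(ḡ, σ) ∈ Fˣ` on the pairs of a tuple `ḡ ∈ Gⁿ` and `σ ∈ Sym(ḡ)`. -/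
abbrev TupleFunction (G F : Type*) [Group G] [Field F] :=
  ∀ (n : ℕ) (g : Fin n → G) (σ : Equiv.Perm (Fin n)), σ ∈ permSym g → Fˣ

/-- The concatenation `(ḡ₁, …, ḡₖ)` of `k` tuples, `ḡᵢ` having length `ν i`. -/
def concat {X : Type*} {k : ℕ} {ν : Fin k → ℕ} (b : ∀ i, Fin (ν i) → X) :
    Fin (∑ i, ν i) → X :=
  fun x => b (finSigmaFinEquiv.symm x).1 (finSigmaFinEquiv.symm x).2

/-- The permutation of `ν 1 + ⋯ + ν k` letters which moves the blocks of sizes `ν 1, …, ν k`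
rigidly according to `σ`: rearranging `(ḡ₁, …, ḡₖ)` along it gives
`(ḡ_{σ(1)}, …, ḡ_{σ(k)})`. -/
def blockPerm {k : ℕ} (ν : Fin k → ℕ) (σ : Equiv.Perm (Fin k)) :
    Equiv.Perm (Fin (∑ i, ν i)) :=
  (finCongr (Equiv.sum_comp σ ν).symm).trans
    ((finSigmaFinEquiv (n := fun i => ν (σ i))).symm.trans
      ((Equiv.sigmaCongrLeft (β := fun i => Fin (ν i)) σ).trans finSigmaFinEquiv))

/-- `G`-commutation functions with values in `Fˣ`. -/
structure IsCommutationFunction {G F : Type*} [Group G] [Field F]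
    (θ : TupleFunction G F) : Prop where
  /-- If `σ ∈ Sym(ḡ)` fixes all positions outside the interval `p, …, p + m - 1`, and `σ'` is its
  restriction to this interval, then `θ(ḡ, σ) = θ((g_p, …, g_{p+m-1}), σ')`. -/
  restrict : ∀ (n m p : ℕ) (hp : p + m ≤ n), 0 < m →
    ∀ (g : Fin n → G) (σ : Equiv.Perm (Fin n)) (σ' : Equiv.Perm (Fin m)),
    (∀ k : Fin n, (k : ℕ) < p ∨ p + m ≤ (k : ℕ) → σ k = k) →
    (∀ k : Fin m, σ ⟨p + k, by omega⟩ = ⟨p + σ' k, by omega⟩) →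
    ∀ (hσ : σ ∈ permSym g) (hσ' : σ' ∈ permSym (fun k : Fin m => g ⟨p + k, by omega⟩)),
    θ n g σ hσ = θ m (fun k : Fin m => g ⟨p + k, by omega⟩) σ' hσ'
  /-- Substituting for every letter `hᵢ` a nonempty tuple with product `hᵢ` does not change the
  value, when the blocks are moved rigidly. -/
  block : ∀ (k : ℕ) (h : Fin k → G) (ν : Fin k → ℕ), (∀ i, 0 < ν i) →
    ∀ b : ∀ i, Fin (ν i) → G, (∀ i, (List.ofFn (b i)).prod = h i) →
    ∀ (σ : Equiv.Perm (Fin k)) (hσ : σ ∈ permSym h)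
      (hσ' : blockPerm ν σ ∈ permSym (concat b)),
    θ k h σ hσ = θ (∑ i, ν i) (concat b) (blockPerm ν σ) hσ'
  /-- Multiplicativity: `θ(ḡ, σ) θ(ḡ^σ, τ) = θ(ḡ, στ)` for `ḡ^σ = (g_{σ(1)}, …, g_{σ(n)})`. -/
  mul : ∀ (n : ℕ) (g : Fin n → G) (σ τ : Equiv.Perm (Fin n)) (hσ : σ ∈ permSym g)
    (hτ : τ ∈ permSym (g ∘ σ)) (hστ : σ * τ ∈ permSym g),
    θ n g σ hσ * θ n (g ∘ σ) τ hτ = θ n g (σ * τ) hστ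

theorem swap_mem_permSym {G : Type*} [Group G] {g h : G} (hc : Commute g h) :
    Equiv.swap (0 : Fin 2) 1 ∈ permSym ![g, h] := by
  simpa [permSym, List.ofFn_succ] using hc.eq

/-- `θ_{g,h} = θ((g,h),(1 2))` for commuting `g, h`. -/
def TupleFunction.pair {G F : Type*} [Group G] [Field F] (θ : TupleFunction G F)
    (g h : G) (hc : Commute g h) : Fˣ :=
  θ 2 ![g, h] (Equiv.swap 0 1) (swap_mem_permSym hc)

/-! ### Gradings and regular gradings -/

/-- `A = ⨁_{g ∈ G} A_g` is a `G`-grading of the unital associative `F`-algebra `A`.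
(That `1 ∈ A_e` is automatic.) -/
structure IsGrading {G F A : Type*} [Group G] [Field F] [Semiring A] [Algebra F A]
    (𝒜 : G → Submodule F A) : Prop where
  indep : iSupIndep 𝒜
  iSup_eq_top : ⨆ g, 𝒜 g = ⊤
  one_mem : (1 : A) ∈ 𝒜 1
  mul_mem : ∀ {g h : G} {a b : A}, a ∈ 𝒜 g → b ∈ 𝒜 h → a * b ∈ 𝒜 (g * h)

/-- The family `(A_g)` is a regular `G`-grading of `A` with commutation function `θ`. -/
structure IsRegularGrading {G F A : Type*} [Group G] [Field F] [Semiring A] [Algebra F A]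
    (𝒜 : G → Submodule F A) (θ : TupleFunction G F) : Prop where
  isGrading : IsGrading 𝒜
  commutation : ∀ (n : ℕ) (g : Fin n → G) (σ : Equiv.Perm (Fin n)) (hσ : σ ∈ permSym g)
    (a : Fin n → A), (∀ i, a i ∈ 𝒜 (g i)) →
    (List.ofFn a).prod = (θ n g σ hσ : F) • (List.ofFn (a ∘ σ)).prod
  regularity : ∀ (n : ℕ) (g : Fin n → G),
    ∃ a : Fin n → A, (∀ i, a i ∈ 𝒜 (g i)) ∧ (List.ofFn a).prod ≠ 0

/-! ### Twisted group algebras -/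

/-- `2`-cocycles of `G` with values in `Fˣ` (trivial action). -/
structure TwoCocycle (G F : Type*) [Group G] [Field F] where
  toFun : G → G → Fˣ
  cocycle : ∀ g h k, toFun g h * toFun (g * h) k = toFun h k * toFun g (h * k)

/-- The underlying space of the twisted group algebra `F^α G`, that of the group algebra. -/
def TwistedGroupAlgebra {G F : Type*} [Group G] [Field F] (_α : TwoCocycle G F) := G →₀ F

namespace TwistedGroupAlgebra

variable {G F : Type*} [Group G] [Field F] (α : TwoCocycle G F)

instance : AddCommGroup (TwistedGroupAlgebra α) := inferInstanceAs (AddCommGroup (G →₀ F))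
instance : Module F (TwistedGroupAlgebra α) := inferInstanceAs (Module F (G →₀ F))

/-- The standard basis. -/
def basis : Module.Basis G F (TwistedGroupAlgebra α) :=
  (Finsupp.basisSingleOne : Module.Basis G F (G →₀ F))

/-- The basis element `U_g`. -/
def U (g : G) : TwistedGroupAlgebra α := basis α g

/-- The bilinear multiplication with `U_g U_h = α(g,h) U_{gh}`. -/
def mulHom : TwistedGroupAlgebra α →ₗ[F] TwistedGroupAlgebra α →ₗ[F] TwistedGroupAlgebra α :=
  (basis α).constr F fun g => (basis α).constr F fun h => (α.toFun g h : F) • U α (g * h)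

instance : Mul (TwistedGroupAlgebra α) := ⟨fun x y => mulHom α x y⟩
instance : One (TwistedGroupAlgebra α) := ⟨((α.toFun 1 1)⁻¹ : F) • U α 1⟩

theorem mul_def (x y : TwistedGroupAlgebra α) : x * y = mulHom α x y := rfl
theorem one_def : (1 : TwistedGroupAlgebra α) = ((α.toFun 1 1)⁻¹ : F) • U α 1 := rfl

theorem U_mul_U (g h : G) : U α g * U α h = (α.toFun g h : F) • U α (g * h) := by
  rw [mul_def, mulHom, U, U, Module.Basis.constr_basis, Module.Basis.constr_basis]

theorem span_U : Submodule.span F (Set.range (U α)) = ⊤ := (basis α).span_eq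

theorem induction {p : TwistedGroupAlgebra α → Prop} (x : TwistedGroupAlgebra α)
    (hU : ∀ g, p (U α g)) (h0 : p 0) (ha : ∀ x y, p x → p y → p (x + y))
    (hs : ∀ (c : F) x, p x → p (c • x)) : p x := by
  have hx : x ∈ Submodule.span F (Set.range (U α)) := by rw [span_U]; trivial
  induction hx using Submodule.span_induction with
  | mem x h => obtain ⟨g, rfl⟩ := h; exact hU g
  | zero => exact h0
  | add x y _ _ hx hy => exact ha x y hx hy
  | smul c x _ hx => exact hs c x hx

theorem add_mul' (x y z : TwistedGroupAlgebra α) : (x + y) * z = x * z + y * z := by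
  simp [mul_def]
theorem mul_add' (x y z : TwistedGroupAlgebra α) : x * (y + z) = x * y + x * z := by
  simp [mul_def]
theorem zero_mul' (x : TwistedGroupAlgebra α) : 0 * x = 0 := by simp [mul_def]
theorem mul_zero' (x : TwistedGroupAlgebra α) : x * 0 = 0 := by simp [mul_def]
theorem smul_mul' (c : F) (x y : TwistedGroupAlgebra α) : (c • x) * y = c • (x * y) := by
  simp [mul_def]
theorem mul_smul' (c : F) (x y : TwistedGroupAlgebra α) : x * (c • y) = c • (x * y) := by
  simp [mul_def]

theorem mul_assoc' (x y z : TwistedGroupAlgebra α) : x * y * z = x * (y * z) := by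
  induction x using induction with
  | h0 => simp only [zero_mul']
  | ha x x' h h' => simp only [add_mul', h, h']
  | hs c x h => simp only [smul_mul', h]
  | hU g =>
    induction y using induction with
    | h0 => simp only [zero_mul', mul_zero']
    | ha x x' h h' => simp only [add_mul', mul_add', h, h']
    | hs c x h => simp only [smul_mul', mul_smul', h]
    | hU h =>
      induction z using induction with
      | h0 => simp only [mul_zero']
      | ha x x' h h' => simp only [mul_add', h, h']
      | hs c x h => simp only [mul_smul', h]
      | hU k =>
        simp only [U_mul_U, smul_mul', mul_smul', smul_smul, mul_assoc]
        congr 1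
        exact_mod_cast α.cocycle g h k

theorem one_mul' (x : TwistedGroupAlgebra α) : 1 * x = x := by
  induction x using induction with
  | h0 => exact mul_zero' α 1
  | ha x x' h h' => rw [mul_add', h, h']
  | hs c x h => rw [mul_smul', h]
  | hU g =>
    have h := α.cocycle 1 1 g
    simp only [one_mul, mul_right_cancel_iff, mul_comm (α.toFun 1 g)] at h
    rw [one_def, smul_mul', U_mul_U, smul_smul, one_mul, ← h]
    simp

theorem mul_one' (x : TwistedGroupAlgebra α) : x * 1 = x := by
  induction x using induction with
  | h0 => exact zero_mul' α 1
  | ha x x' h h' => rw [add_mul', h, h']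
  | hs c x h => rw [smul_mul', h]
  | hU g =>
    have h := α.cocycle g 1 1
    simp only [mul_one, mul_right_cancel_iff] at h
    rw [one_def, mul_smul', U_mul_U, smul_smul, mul_one, h]
    simp

instance : Ring (TwistedGroupAlgebra α) :=
  { (inferInstance : AddCommGroup (TwistedGroupAlgebra α)) with
    mul := (· * ·)
    one := 1
    left_distrib := mul_add' α
    right_distrib := add_mul' α
    zero_mul := zero_mul' α
    mul_zero := mul_zero' α
    mul_assoc := mul_assoc' α
    one_mul := one_mul' α
    mul_one := mul_one' α }

instance : Algebra F (TwistedGroupAlgebra α) :=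
  Algebra.ofModule (smul_mul' α) (mul_smul' α)

/-- The homogeneous component `B_g = F U_g` of `B = F^α G`. -/
def component (g : G) : Submodule F (TwistedGroupAlgebra α) := Submodule.span F {U α g}

/-- The decomposition of `B = F^α G` into `B_1 = ⨁_{h ∈ H} B_h` and `B_{-1} = ⨁_{g ∉ H} B_g`,
indexed by the group `{±1}`. -/
def cosetPart (H : Subgroup G) (ε : ℤˣ) : Submodule F (TwistedGroupAlgebra α) :=
  if ε = 1 then ⨆ h ∈ {h : G | h ∈ H}, component α h else ⨆ g ∈ {g : G | g ∉ H}, component α g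

theorem mem_cosetPart_iff (ψ : G →* ℤˣ) (ε : ℤˣ) (x : TwistedGroupAlgebra α) :
    x ∈ cosetPart α ψ.ker ε ↔ x ∈ Submodule.span F (U α '' {g | ψ g = ε}) := by
  have key : ∀ s : Set G, ⨆ g ∈ s, component α g = Submodule.span F (U α '' s) := by
    intro s
    rw [← Set.biUnion_of_singleton (U α '' s), Submodule.span_iUnion₂, iSup_image]
    rfl
  unfold cosetPart
  rcases Int.units_eq_one_or ε with rfl | rfl
  · rw [if_pos rfl, key]; rfl
  · rw [if_neg (by decide), key]
    have : {g : G | g ∉ ψ.ker} = {g | ψ g = -1} := by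
      ext g
      simp only [Set.mem_ofPred_eq, MonoidHom.mem_ker]
      rcases Int.units_eq_one_or (ψ g) with h | h <;> rw [h] <;> decide
    rw [this]

theorem cosetPart_isGrading (ψ : G →* ℤˣ) : IsGrading (cosetPart α ψ.ker) where
  indep := by
    have e : cosetPart α ψ.ker = fun ε => Submodule.span F (U α '' {g | ψ g = ε}) := by
      funext ε
      ext x
      exact mem_cosetPart_iff α ψ ε x
    rw [e]
    refine iSupIndep_def.2 fun ε => ?_
    refine Disjoint.mono_right (b := _)
      (c := Submodule.span F (U α '' {g | ψ g ≠ ε})) ?_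
      ((basis α).linearIndependent.disjoint_span_image ?_)
    · refine iSup₂_le fun ε' hε => Submodule.span_mono (Set.image_mono ?_)
      rintro g rfl
      exact hε
    · rw [Set.disjoint_left]
      exact fun g h h' => h' h
  iSup_eq_top := by
    rw [eq_top_iff, ← span_U, Submodule.span_le]
    rintro _ ⟨g, rfl⟩
    refine Submodule.mem_iSup_of_mem (ψ g) ?_
    rw [mem_cosetPart_iff]
    exact Submodule.subset_span ⟨g, rfl, rfl⟩
  one_mem := by
    rw [mem_cosetPart_iff, one_def]
    exact Submodule.smul_mem _ _ (Submodule.subset_span ⟨1, map_one ψ, rfl⟩)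
  mul_mem := by
    intro ε ε' a b ha hb
    rw [mem_cosetPart_iff] at *
    have := Submodule.mul_mem_mul ha hb
    rw [Submodule.span_mul_span] at this
    refine Submodule.span_le.2 ?_ this
    rintro _ ⟨_, ⟨g, rfl, rfl⟩, _, ⟨h, rfl, rfl⟩, rfl⟩
    change U α g * U α h ∈ _
    rw [U_mul_U]
    exact Submodule.smul_mem _ _ (Submodule.subset_span ⟨g * h, map_mul ψ g h, rfl⟩)

end TwistedGroupAlgebra

/-! ### The Grassmann algebra and Grassmann envelopes -/

/-- The infinite dimensional Grassmann algebra `E` over `F`, generated by `e_i`, `i ∈ ℕ`. -/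
abbrev Grassmann (F : Type*) [Field F] := ExteriorAlgebra F (ℕ →₀ F)

/-- The grading `E = E_1 ⊕ E_{-1}` of the Grassmann algebra by `{±1}`: `E_1` is the span of the
products of an even number of generators and `E_{-1}` that of the products of an odd number. -/
def grassmannPart (F : Type*) [Field F] (ε : ℤˣ) : Submodule F (Grassmann F) :=
  CliffordAlgebra.evenOdd (0 : QuadraticForm F (ℕ →₀ F)) (if ε = 1 then 0 else 1)

theorem one_mem_grassmannPart (F : Type*) [Field F] : (1 : Grassmann F) ∈ grassmannPart F 1 := by
  rw [grassmannPart, if_pos rfl]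
  exact Submodule.one_le.1 (CliffordAlgebra.one_le_evenOdd_zero _)

theorem mul_mem_grassmannPart {F : Type*} [Field F] {ε ε' : ℤˣ} {x y : Grassmann F}
    (hx : x ∈ grassmannPart F ε) (hy : y ∈ grassmannPart F ε') :
    x * y ∈ grassmannPart F (ε * ε') := by
  have h := CliffordAlgebra.evenOdd_mul_le _ _ _ (Submodule.mul_mem_mul hx hy)
  have e : ((if ε = 1 then 0 else 1) + (if ε' = 1 then 0 else 1) : ZMod 2) =
      if ε * ε' = 1 then 0 else 1 := by
    clear h hx hy
    revert ε ε'; decide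
  rw [e] at h
  exact h

/-- The Grassmann envelope `(B_1 ⊗ E_1) ⊕ (B_{-1} ⊗ E_{-1})`, a subalgebra of `B ⊗ E`, of an
algebra `B = B_1 ⊕ B_{-1}` graded by `{±1}`. -/
def grassmannEnvelope {F B : Type*} [Field F] [Ring B] [Algebra F B]
    (ℬ : ℤˣ → Submodule F B) (hℬ : IsGrading ℬ) : Subalgebra F (B ⊗[F] Grassmann F) :=
  (⨆ ε : ℤˣ, Submodule.map₂ (TensorProduct.mk F B (Grassmann F)) (ℬ ε)
      (grassmannPart F ε)).toSubalgebra
    (Submodule.mem_iSup_of_mem 1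
      (Submodule.apply_mem_map₂ _ hℬ.one_mem (one_mem_grassmannPart F)))
    (by
      intro x y hx hy
      refine SetLike.le_def.1 ?_ (Submodule.mul_mem_mul hx hy)
      rw [Submodule.iSup_mul]
      refine iSup_le fun ε => ?_
      rw [Submodule.mul_iSup]
      refine iSup_le fun ε' => le_trans ?_ (le_iSup _ (ε * ε'))
      rw [Submodule.map₂_eq_span_image2, Submodule.map₂_eq_span_image2, Submodule.span_mul_span,
        Submodule.span_le]
      rintro _ ⟨_, ⟨a, ha, u, hu, rfl⟩, _, ⟨b, hb, v, hv, rfl⟩, rfl⟩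
      change (a ⊗ₜ[F] u) * (b ⊗ₜ[F] v) ∈ _
      rw [Algebra.TensorProduct.tmul_mul_tmul]
      exact Submodule.apply_mem_map₂ _ (hℬ.mul_mem ha hb) (mul_mem_grassmannPart hu hv))

/-- The Grassmann envelope `B̃` of `B = F^α G`, where `B` is graded by `{±1}` through
`B_1 = ⨁_{h ∈ H} B_h` and `B_{-1} = ⨁_{g ∉ H} B_g` with `H = ker ψ`. -/
abbrev twistedEnvelope {G F : Type*} [Group G] [Field F] (α : TwoCocycle G F) (ψ : G →* ℤˣ) :
    Subalgebra F (TwistedGroupAlgebra α ⊗[F] Grassmann F) :=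
  grassmannEnvelope (TwistedGroupAlgebra.cosetPart α ψ.ker)
    (TwistedGroupAlgebra.cosetPart_isGrading α ψ)

/-- The natural `G`-grading of the Grassmann envelope of `F^α G`: the component of degree `g` is
`B_g ⊗ E_1` if `g ∈ H = ker ψ`, and `B_g ⊗ E_{-1}` if `g ∉ H`. -/
def twistedEnvelopePart {G F : Type*} [Group G] [Field F] (α : TwoCocycle G F) (ψ : G →* ℤˣ)
    (g : G) : Submodule F (twistedEnvelope α ψ) :=
  Submodule.comap (twistedEnvelope α ψ).val.toLinearMap
    (Submodule.map₂ (TensorProduct.mk F (TwistedGroupAlgebra α) (Grassmann F))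
      (TwistedGroupAlgebra.component α g) (grassmannPart F (ψ g)))

end RegularGrading

end

open scoped TensorProduct

noncomputable section

namespace RegularGrading

/-! ### Tuples as words, and the values of a commutation function on stabilizers. -/

section

/-! The values θ_{g,g} are signs, and they are multiplicative in g because exchanging the two halves
of (g,h,g,h) is a product of two transpositions of equal letters (`pair_mul`). Let ψ(g) = θ_{g,g}.
The Grassmann algebra with degrees ψ(g) has its own commutation function
(`isCommutationFunction_signFunction`) with the same diagonal values, so the quotient η of θ by it
is a commutation function with η_{g,g} = 1.

The stabilizer of a tuple is generated by transpositions of equal letters, so η is trivial on it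
(`eq_one_of_comp_eq`) and depends only on the words before and after rearranging. On scalar
multiples of words with product 1, identify each word with η times its rearrangement. The resulting
monoid is commutative, and scalars stay distinct in its Grothendieck group. Since Fˣ is divisible,
that group retracts onto Fˣ. This yields a multiplicative function on words with product 1 that
transforms by η (`exists_character`). Closing a word with the inverse of its product extends it to a
function f on all words. The values of f on two-letter words form the cocycle α (`exists_cocycle`),
and f(w) is the coefficient in the product of the U_g along w. So these products rearrange by η, and
tensoring with E restores the sign. -/

theorem concat_finSigmaFinEquiv {X : Type*} {k : ℕ} {ν : Fin k → ℕ} (b : ∀ i, Fin (ν i) → X)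
    (s : (i : Fin k) × Fin (ν i)) : concat b (finSigmaFinEquiv s) = b s.1 s.2 :=
  congrArg (fun p : (i : Fin k) × Fin (ν i) => b p.1 p.2) (Equiv.symm_apply_apply _ s)

theorem ofFn_concat {X : Type*} : ∀ {k : ℕ} {ν : Fin k → ℕ} (b : ∀ i, Fin (ν i) → X),
    List.ofFn (concat b) = (List.ofFn fun i => List.ofFn (b i)).flatten := by
  intro k
  induction k with
  | zero => intro ν b; simp
  | succ k ih =>
    intro ν b
    have h : List.ofFn (concat b) = List.ofFn
        (Fin.append (concat fun i : Fin k => b i.castSucc) (b (Fin.last k))) := by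
      -- The last block is split off, and the index types are matched by a cast along the splitting
      -- of the sum of lengths.
      rw [List.ofFn_congr (Fin.sum_univ_castSucc ν)]
      congr 1
      funext x
      have key : ∀ y : Fin (∑ i, ν i), concat b y = Fin.append
          (concat fun i : Fin k => b i.castSucc) (b (Fin.last k))
          (Fin.cast (Fin.sum_univ_castSucc ν) y) := by
        intro y
        obtain ⟨⟨i, j⟩, rfl⟩ := finSigmaFinEquiv.surjective y
        induction i using Fin.lastCases with
        | last =>
          have e : Fin.cast (Fin.sum_univ_castSucc ν) (finSigmaFinEquiv ⟨Fin.last k, j⟩) =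
              Fin.natAdd (∑ i : Fin k, ν i.castSucc) j := by
            ext; simp only [Fin.val_cast, finSigmaFinEquiv_apply, Fin.val_natAdd]; rfl
          rw [e, Fin.append_right, concat_finSigmaFinEquiv]
        | cast i =>
          have e : Fin.cast (Fin.sum_univ_castSucc ν) (finSigmaFinEquiv ⟨i.castSucc, j⟩) =
              Fin.castAdd _ (finSigmaFinEquiv (n := fun i : Fin k => ν i.castSucc) ⟨i, j⟩) := by
            ext; simp only [Fin.val_cast, finSigmaFinEquiv_apply, Fin.val_castAdd]; rfl
          rw [e, Fin.append_left, concat_finSigmaFinEquiv, concat_finSigmaFinEquiv]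
      rw [key]; rfl
    rw [h, List.ofFn_fin_append, ih, List.ofFn_succ', List.concat_eq_append, List.flatten_append]
    simp

theorem ofFn_concat_comp_blockPerm {X : Type*} {k : ℕ} {ν : Fin k → ℕ} (b : ∀ i, Fin (ν i) → X)
    (σ : Equiv.Perm (Fin k)) :
    List.ofFn (concat b ∘ blockPerm ν σ) = (List.ofFn fun i => List.ofFn (b (σ i))).flatten := by
  rw [← ofFn_concat (fun i => b (σ i)), List.ofFn_congr (Equiv.sum_comp σ ν).symm]
  congr 1
  funext x
  exact concat_finSigmaFinEquiv b _

theorem ofFn_eq_append {X : Type*} {n m p q : ℕ} (h : p + m + q = n) (x : Fin n → X) :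
    List.ofFn x = List.ofFn (fun i : Fin p => x ⟨i, by omega⟩) ++
      (List.ofFn (fun i : Fin m => x ⟨p + i, by omega⟩) ++
        List.ofFn (fun i : Fin q => x ⟨p + m + i, by omega⟩)) := by
  subst h
  rw [List.ofFn_add, List.ofFn_add, List.append_assoc]
  rfl

/-- The permutation of `a + n + b` letters moving only the `n` letters in the middle. -/
def midPerm (a n b : ℕ) (σ : Equiv.Perm (Fin n)) : Equiv.Perm (Fin (a + n + b)) :=
  finSumFinEquiv.permCongr
    (Equiv.sumCongr (finSumFinEquiv.permCongr (Equiv.sumCongr 1 σ)) 1)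

theorem midPerm_mid {a n b : ℕ} (σ : Equiv.Perm (Fin n)) (i : Fin n) :
    midPerm a n b σ (Fin.castAdd b (Fin.natAdd a i)) = Fin.castAdd b (Fin.natAdd a (σ i)) := by
  simp [midPerm, Equiv.permCongr_apply]

theorem midPerm_left {a n b : ℕ} (σ : Equiv.Perm (Fin n)) (i : Fin a) :
    midPerm a n b σ (Fin.castAdd b (Fin.castAdd n i)) = Fin.castAdd b (Fin.castAdd n i) := by
  simp [midPerm, Equiv.permCongr_apply]

theorem midPerm_right {a n b : ℕ} (σ : Equiv.Perm (Fin n)) (i : Fin b) :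
    midPerm a n b σ (Fin.natAdd (a + n) i) = Fin.natAdd (a + n) i := by
  simp [midPerm, Equiv.permCongr_apply]

theorem midPerm_swap {a n b : ℕ} (i j : Fin n) :
    midPerm a n b (Equiv.swap i j) = Equiv.swap (Fin.castAdd b (Fin.natAdd a i))
      (Fin.castAdd b (Fin.natAdd a j)) := by
  ext x : 1
  induction x using Fin.addCases with
  | left x =>
    induction x using Fin.addCases with
    | left x =>
      rw [midPerm_left, Equiv.swap_apply_of_ne_of_ne] <;>
        simp [Fin.ext_iff] <;> omega
    | right x =>
      rw [midPerm_mid]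
      exact (((Fin.castAdd_injective _ b).comp (Fin.natAdd_injective _ a)).swap_apply i j x).symm
  | right x =>
    rw [midPerm_right, Equiv.swap_apply_of_ne_of_ne] <;>
      simp [Fin.ext_iff] <;> omega

theorem append_comp_midPerm {X : Type*} {a n b : ℕ} (u : Fin a → X) (g : Fin n → X)
    (v : Fin b → X) (σ : Equiv.Perm (Fin n)) :
    Fin.append (Fin.append u g) v ∘ midPerm a n b σ =
      Fin.append (Fin.append u (g ∘ σ)) v := by
  funext x
  induction x using Fin.addCases with
  | left x =>
    induction x using Fin.addCases with
    | left x => simp [midPerm_left]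
    | right x => simp [midPerm_mid]
  | right x => simp [midPerm_right]

variable {G F : Type*} [Group G] [Field F] {θ : TupleFunction G F}

theorem TupleFunction.congr (θ : TupleFunction G F) {n : ℕ} {g g' : Fin n → G}
    {σ σ' : Equiv.Perm (Fin n)} (hg : g = g') (hs : σ = σ') (h : σ ∈ permSym g)
    (h' : σ' ∈ permSym g') : θ n g σ h = θ n g' σ' h' := by
  subst hg; subst hs; rfl

theorem mem_permSym_of_comp_eq {n : ℕ} {g : Fin n → G} {σ : Equiv.Perm (Fin n)} (h : g ∘ σ = g) :
    σ ∈ permSym g := by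
  simp [permSym, h]

/-- The restriction axiom read backwards: padding a tuple on both sides by fixed letters leaves the
value unchanged. -/
theorem IsCommutationFunction.append (hθ : IsCommutationFunction θ) {a n b : ℕ} (u : Fin a → G)
    (g : Fin n → G) (v : Fin b → G) (hn : 0 < n) (σ : Equiv.Perm (Fin n)) (hσ : σ ∈ permSym g)
    (hσ' : midPerm a n b σ ∈ permSym (Fin.append (Fin.append u g) v)) :
    θ _ (Fin.append (Fin.append u g) v) (midPerm a n b σ) hσ' = θ n g σ hσ := by
  have e : (fun k : Fin n => Fin.append (Fin.append u g) v ⟨a + k, by omega⟩) = g := by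
    funext k
    change Fin.append (Fin.append u g) v (Fin.castAdd b (Fin.natAdd a k)) = _
    simp
  rw [hθ.restrict (a + n + b) n a (by omega) hn _ (midPerm a n b σ) σ ?_ ?_ hσ' (by rwa [e])]
  · exact θ.congr e rfl _ _
  · intro k hk
    induction k using Fin.addCases with
    | left x =>
      induction x using Fin.addCases with
      | left x => exact midPerm_left σ x
      | right x =>
        simp at hk
        omega
    | right x => exact midPerm_right σ x
  · intro k
    exact midPerm_mid σ k

theorem IsCommutationFunction.eq_one_of_eq_one (hθ : IsCommutationFunction θ) {n : ℕ}
    (g : Fin n → G) (h : 1 ∈ permSym g) : θ n g 1 h = 1 := by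
  have := hθ.mul n g 1 1 h h h
  have e : θ n (g ∘ (1 : Equiv.Perm (Fin n))) 1 h = θ n g 1 h := rfl
  rw [e] at this
  have e2 : θ n g (1 * 1) h = θ n g 1 h := θ.congr rfl (mul_one 1) _ _
  rw [e2] at this
  simpa using this

/-- `θ(ḡ, ·)` is multiplicative on the permutations which fix `ḡ`. -/
theorem IsCommutationFunction.mul_stabilizer (hθ : IsCommutationFunction θ) {n : ℕ}
    {g : Fin n → G} {σ τ : Equiv.Perm (Fin n)} (hσ : g ∘ σ = g) (hτ : g ∘ τ = g)
    (hστ : g ∘ (σ * τ : Equiv.Perm (Fin n)) = g) :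
    θ n g (σ * τ) (mem_permSym_of_comp_eq hστ) =
      θ n g σ (mem_permSym_of_comp_eq hσ) * θ n g τ (mem_permSym_of_comp_eq hτ) := by
  rw [← hθ.mul n g σ τ (mem_permSym_of_comp_eq hσ) (by rw [hσ]; exact mem_permSym_of_comp_eq hτ)]
  congr 1
  exact θ.congr hσ rfl _ _

theorem comp_swap_eq {X : Type*} {n : ℕ} {g : Fin n → X} {i j : Fin n} (h : g i = g j) :
    g ∘ Equiv.swap i j = g := by
  funext k
  by_cases hi : k = i
  · subst hi; simp [h]
  by_cases hj : k = j
  · subst hj; simp [h]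
  simp [Equiv.swap_apply_of_ne_of_ne hi hj]

theorem comp_mul_eq {X : Type*} {n : ℕ} {g : Fin n → X} {σ τ : Equiv.Perm (Fin n)}
    (hσ : g ∘ σ = g) (hτ : g ∘ τ = g) : g ∘ (σ * τ : Equiv.Perm (Fin n)) = g := by
  rw [Equiv.Perm.coe_mul, ← Function.comp_assoc, hσ, hτ]

/-- All transpositions of two letters equal to `x` have the same value. -/
theorem IsCommutationFunction.swap_eq_swap (hθ : IsCommutationFunction θ) {n : ℕ}
    {g : Fin n → G} {i j k l : Fin n} (hij : g i = g j) (hkl : g k = g l) (hik : g i = g k)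
    (hil : i ≠ l) (hkj' : i ≠ j) (hkl' : k ≠ l) :
    θ n g (Equiv.swap i j) (mem_permSym_of_comp_eq (comp_swap_eq hij)) =
      θ n g (Equiv.swap k l) (mem_permSym_of_comp_eq (comp_swap_eq hkl)) := by
  -- ρ carries i to k and j to l, hence conjugates one transposition into the other. It fixes the
  -- tuple, and conjugate elements of the stabilizer have the same value because Fˣ is commutative.
  set ρ : Equiv.Perm (Fin n) := Equiv.swap i k * Equiv.swap j l with hρ
  have hρg : g ∘ ρ = g := comp_mul_eq (comp_swap_eq hik) (comp_swap_eq (by rw [← hij, hik, hkl]))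
  have e : ρ * Equiv.swap i j = Equiv.swap k l * ρ := by
    have h1 : ρ i = k := by
      simp [hρ, Equiv.swap_apply_of_ne_of_ne hkj' hil]
    have h2 : ρ j = l := by
      simp [hρ, Equiv.swap_apply_of_ne_of_ne hil.symm hkl'.symm]
    rw [← h1, ← h2, Equiv.mul_swap_eq_swap_mul]
  have h1 := hθ.mul_stabilizer hρg (comp_swap_eq hij) (comp_mul_eq hρg (comp_swap_eq hij))
  have h2 := hθ.mul_stabilizer (comp_swap_eq hkl) hρg (comp_mul_eq (comp_swap_eq hkl) hρg)
  rw [θ.congr rfl e _ (mem_permSym_of_comp_eq (comp_mul_eq (comp_swap_eq hkl) hρg)), h2,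
    mul_comm] at h1
  exact (mul_left_cancel h1).symm

/-- The positions i and j need not be adjacent, so the restriction axiom does not apply directly.
Two further copies of the letter `g i` are appended: their transposition has value θ_{x,x} by
restriction, and it is conjugate to the given one. -/
theorem IsCommutationFunction.swap_eq_pair (hθ : IsCommutationFunction θ) {n : ℕ}
    {g : Fin n → G} {i j : Fin n} (hij : g i = g j) (hne : i ≠ j) :
    θ n g (Equiv.swap i j) (mem_permSym_of_comp_eq (comp_swap_eq hij)) =
      θ.pair (g i) (g i) (Commute.refl _) := by
  have hn : 0 < n := i.pos
  let u := Fin.append (Fin.elim0 : Fin 0 → G) g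
  have e1 := hθ.append (Fin.elim0 : Fin 0 → G) g ![g i, g i] hn (Equiv.swap i j)
    (mem_permSym_of_comp_eq (comp_swap_eq hij)) (mem_permSym_of_comp_eq (by
      rw [append_comp_midPerm, comp_swap_eq hij]))
  have e2 := hθ.append u ![g i, g i] (Fin.elim0 : Fin 0 → G) two_pos (Equiv.swap 0 1)
    (swap_mem_permSym (Commute.refl _)) (mem_permSym_of_comp_eq (by
      rw [append_comp_midPerm, comp_swap_eq (by simp)]))
  rw [← e1, TupleFunction.pair, ← e2]
  have hi : ∀ k, Fin.append u ![g i, g i] (Fin.castAdd 2 (Fin.natAdd 0 k)) = g k := by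
    intro k; simp [u]
  have hr : ∀ k, Fin.append u ![g i, g i] (Fin.natAdd (0 + n) k) = g i := by
    intro k; fin_cases k <;> simp
  have key := hθ.swap_eq_swap (g := Fin.append u ![g i, g i])
    (i := Fin.castAdd 2 (Fin.natAdd 0 i)) (j := Fin.castAdd 2 (Fin.natAdd 0 j))
    (k := Fin.natAdd (0 + n) 0) (l := Fin.natAdd (0 + n) 1)
    (by rw [hi, hi, hij]) (by rw [hr, hr]) (by rw [hi, hr])
    (by simp [Fin.ext_iff]; omega)
    (by simpa [Fin.ext_iff] using fun h => hne (Fin.ext h)) (by simp [Fin.ext_iff])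
  rw [θ.congr rfl (midPerm_swap i j) _ (mem_permSym_of_comp_eq (comp_swap_eq
    (by rw [hi, hi, hij])))]
  refine key.trans ?_
  refine θ.congr ?_ ?_ _ _
  · exact (Fin.append_elim0 (Fin.append u ![g i, g i])).symm
  · exact (midPerm_swap (b := 0) (0 : Fin 2) 1).symm

/-- If all values `θ_{x,x}` are trivial, then so is `θ(ḡ, ·)` on the stabilizer of `ḡ`. -/
theorem IsCommutationFunction.eq_one_of_comp_eq (hθ : IsCommutationFunction θ)
    (h1 : ∀ x, θ.pair x x (Commute.refl x) = 1) {n : ℕ} {g : Fin n → G} :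
    ∀ (σ : Equiv.Perm (Fin n)) (hσ : g ∘ σ = g), θ n g σ (mem_permSym_of_comp_eq hσ) = 1 := by
  intro σ
  induction hm : σ.support.card using Nat.strong_induction_on generalizing σ with
  | _ m ih =>
    intro hσ
    by_cases h : σ = 1
    · subst h; exact hθ.eq_one_of_eq_one g _
    obtain ⟨i, hi⟩ : ∃ i, σ i ≠ i := by
      by_contra! hc
      exact h (Equiv.ext hc)
    -- Multiplying by the transposition of i and σ i makes the support strictly smaller and costs
    -- only a factor θ_{x,x} = 1.
    have hgi : g i = g (σ i) := (congrFun hσ i).symm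
    have hs := comp_swap_eq hgi
    have hc := comp_mul_eq hs hσ
    have hlt := Equiv.Perm.card_support_swap_mul hi
    have e := hθ.mul_stabilizer hs hσ hc
    rw [ih _ (hm ▸ hlt) _ rfl hc, hθ.swap_eq_pair hgi hi.symm, h1, one_mul] at e
    exact e.symm

end

/-! ### The sign homomorphism, and rearrangement of words. -/

section

variable {G F : Type*} [Group G] [Field F] {θ : TupleFunction G F}

theorem blockPerm_two_swap : blockPerm (fun _ : Fin 2 => 2) (Equiv.swap 0 1) =
    Equiv.swap (finSigmaFinEquiv ⟨0, 0⟩) (finSigmaFinEquiv ⟨1, 0⟩) *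
      Equiv.swap (finSigmaFinEquiv ⟨0, 1⟩) (finSigmaFinEquiv ⟨1, 1⟩) := by
  decide

/-- The block axiom replaces (gh, gh) by (g,h,g,h), where the rigid exchange swaps the two letters g
and the two letters h separately. -/
theorem IsCommutationFunction.pair_mul (hθ : IsCommutationFunction θ) (g h : G) :
    θ.pair (g * h) (g * h) (Commute.refl _) =
      θ.pair g g (Commute.refl g) * θ.pair h h (Commute.refl h) := by
  let b : ∀ i : Fin 2, Fin ((fun _ : Fin 2 => 2) i) → G := fun _ => ![g, h]
  have h0 : concat b (finSigmaFinEquiv ⟨0, 0⟩) = concat b (finSigmaFinEquiv ⟨1, 0⟩) := by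
    rw [concat_finSigmaFinEquiv, concat_finSigmaFinEquiv]
  have h1 : concat b (finSigmaFinEquiv ⟨0, 1⟩) = concat b (finSigmaFinEquiv ⟨1, 1⟩) := by
    rw [concat_finSigmaFinEquiv, concat_finSigmaFinEquiv]
  have hc := comp_mul_eq (comp_swap_eq h0) (comp_swap_eq h1)
  have hb : blockPerm (fun _ : Fin 2 => 2) (Equiv.swap 0 1) ∈ permSym (concat b) := by
    rw [blockPerm_two_swap]
    exact mem_permSym_of_comp_eq hc
  have e := hθ.block 2 ![g * h, g * h] (fun _ => 2) (fun _ => two_pos) b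
    (fun i => by fin_cases i <;> simp [b]) (Equiv.swap 0 1) (swap_mem_permSym (Commute.refl _)) hb
  rw [TupleFunction.pair, e, θ.congr rfl blockPerm_two_swap _ (mem_permSym_of_comp_eq hc),
    hθ.mul_stabilizer (comp_swap_eq h0) (comp_swap_eq h1) hc, hθ.swap_eq_pair h0 (by decide),
    hθ.swap_eq_pair h1 (by decide)]
  simp only [concat_finSigmaFinEquiv]
  rfl

theorem IsCommutationFunction.pair_sq (hθ : IsCommutationFunction θ) (g : G) :
    θ.pair g g (Commute.refl g) * θ.pair g g (Commute.refl g) = 1 := by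
  have hs : ![g, g] ∘ Equiv.swap (0 : Fin 2) 1 = ![g, g] := comp_swap_eq rfl
  have h := hθ.mul_stabilizer hs hs (comp_mul_eq hs hs)
  rw [TupleFunction.pair, ← h, θ.congr rfl (Equiv.swap_mul_self _ _) _
    (mem_permSym_of_comp_eq rfl), hθ.eq_one_of_eq_one]

/-- The homomorphism `g ↦ θ_{g,g}` to `{±1}`. -/
theorem IsCommutationFunction.exists_sign (hθ : IsCommutationFunction θ) [CharZero F] :
    ∃ ψ : G →* ℤˣ, ∀ g : G, θ.pair g g (Commute.refl g) = Units.map (Int.castRingHom F) (ψ g) := by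
  -- Characteristic zero makes {±1} embed in Fˣ, so multiplicativity can be checked there.
  have inj : Function.Injective (Units.map (Int.castRingHom F : ℤ →* F)) :=
    Units.map_injective (RingHom.injective_int (Int.castRingHom F))
  have ex : ∀ g : G, ∃ ε : ℤˣ, θ.pair g g (Commute.refl g) =
      Units.map (Int.castRingHom F : ℤ →* F) ε := by
    intro g
    have h : (θ.pair g g (Commute.refl g) : F) * θ.pair g g (Commute.refl g) = 1 := by
      rw [← Units.val_mul, hθ.pair_sq, Units.val_one]
    rcases mul_self_eq_one_iff.1 h with h | h
    · exact ⟨1, Units.ext (by simp [h])⟩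
    · exact ⟨-1, Units.ext (by simp [h])⟩
  choose ψ hψ using ex
  refine ⟨MonoidHom.mk' ψ fun g h => inj ?_, hψ⟩
  rw [map_mul, ← hψ, ← hψ, ← hψ, hθ.pair_mul]

/-- The words `w` and `v` have the same product, `v` is a rearrangement of `w`, and `c` is the
value of `θ` at this rearrangement. -/
def TupleFunction.Rel (θ : TupleFunction G F) (w v : List G) (c : Fˣ) : Prop :=
  ∃ (n : ℕ) (g : Fin n → G) (σ : Equiv.Perm (Fin n)) (hσ : σ ∈ permSym g),
    w = List.ofFn g ∧ v = List.ofFn (g ∘ σ) ∧ c = θ n g σ hσ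

theorem TupleFunction.Rel.prod_eq {w v : List G} {c : Fˣ} (h : θ.Rel w v c) : w.prod = v.prod := by
  obtain ⟨n, g, σ, hσ, rfl, rfl, rfl⟩ := h
  exact hσ

namespace IsCommutationFunction
variable (hθ : IsCommutationFunction θ)
include hθ

theorem rel_refl (w : List G) : θ.Rel w w 1 :=
  ⟨w.length, w.get, 1, mem_permSym_of_comp_eq rfl, by simp, by simp,
    (hθ.eq_one_of_eq_one _ _).symm⟩

theorem rel_trans {u v w : List G} {c d : Fˣ} (h : θ.Rel u v c) (h' : θ.Rel v w d) :
    θ.Rel u w (c * d) := by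
  obtain ⟨n, g, σ, hσ, rfl, rfl, rfl⟩ := h
  obtain ⟨m, g', τ, hτ, e, rfl, rfl⟩ := h'
  obtain ⟨rfl, e⟩ := Sigma.mk.inj (List.ofFn_inj'.1 e)
  obtain rfl := eq_of_heq e
  have hm : σ * τ ∈ permSym g := hσ.trans hτ
  exact ⟨n, g, σ * τ, hm, rfl, rfl, hθ.mul n g σ τ hσ hτ hm⟩

theorem rel_symm {u v : List G} {c : Fˣ} (h : θ.Rel u v c) : θ.Rel v u c⁻¹ := by
  obtain ⟨n, g, σ, hσ, rfl, rfl, rfl⟩ := h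
  have e : (g ∘ σ) ∘ (σ⁻¹ : Equiv.Perm (Fin n)) = g := by
    funext x; simp
  have h' : σ⁻¹ ∈ permSym (g ∘ σ) := by
    simp only [permSym, Set.mem_ofPred_eq, e]; exact hσ.symm
  refine ⟨n, g ∘ σ, σ⁻¹, h', rfl, by rw [e], ?_⟩
  have := hθ.mul n g σ σ⁻¹ hσ h' (by rw [mul_inv_cancel]; rfl)
  rw [θ.congr rfl (mul_inv_cancel σ) _ (mem_permSym_of_comp_eq rfl), hθ.eq_one_of_eq_one] at this
  exact inv_eq_of_mul_eq_one_right this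

theorem rel_append {u v : List G} {c : Fˣ} (x y : List G) (h : θ.Rel u v c) :
    θ.Rel (x ++ u ++ y) (x ++ v ++ y) c := by
  obtain ⟨n, g, σ, hσ, rfl, rfl, rfl⟩ := h
  -- The restriction axiom concerns nonempty intervals only, so the empty word is treated apart.
  obtain rfl | hn := Nat.eq_zero_or_pos n
  · rw [θ.congr rfl (Subsingleton.elim σ 1) _ (mem_permSym_of_comp_eq rfl), hθ.eq_one_of_eq_one]
    exact hθ.rel_refl _
  have hm : midPerm x.length n y.length σ ∈ permSym (Fin.append (Fin.append x.get g) y.get) := by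
    simp only [permSym, Set.mem_ofPred_eq, append_comp_midPerm]
    simpa [List.ofFn_fin_append] using! hσ
  refine ⟨_, _, midPerm x.length n y.length σ, hm, ?_, ?_, (hθ.append _ _ _ hn _ _ _).symm⟩
  · simp [List.ofFn_fin_append]
  · simp [append_comp_midPerm, List.ofFn_fin_append]

/-- The block axiom for words; the blocks must be nonempty. -/
theorem rel_flatten {k : ℕ} (L : Fin k → List G) (hL : ∀ i, L i ≠ []) (σ : Equiv.Perm (Fin k))
    (hσ : σ ∈ permSym fun i => (L i).prod) :
    θ.Rel (List.ofFn L).flatten (List.ofFn (L ∘ σ)).flatten (θ k (fun i => (L i).prod) σ hσ) := by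
  have e1 : List.ofFn (concat fun i => (L i).get) = (List.ofFn L).flatten := by
    rw [ofFn_concat]; simp only [List.ofFn_get]
  have e2 : List.ofFn ((concat fun i => (L i).get) ∘ blockPerm (fun i => (L i).length) σ) =
      (List.ofFn (L ∘ σ)).flatten := by
    rw [ofFn_concat_comp_blockPerm]; simp only [List.ofFn_get]; rfl
  have hb : blockPerm (fun i => (L i).length) σ ∈ permSym (concat fun i => (L i).get) := by
    have e : ∀ M : Fin k → List G, (List.ofFn M).map List.prod =
        List.ofFn fun i => (M i).prod := fun M => by rw [List.map_ofFn]; rfl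
    change (List.ofFn _).prod = (List.ofFn _).prod
    rw [e1, e2, List.prod_flatten, List.prod_flatten, e, e]
    exact hσ
  exact ⟨_, _, _, hb, e1.symm, e2.symm, hθ.block k _ _ (fun i => List.length_pos_iff.2 (hL i)) _
    (fun i => by simp) σ hσ hb⟩

theorem rel_comm {u v : List G} (hu : u ≠ []) (hv : v ≠ []) (hc : Commute u.prod v.prod) :
    θ.Rel (u ++ v) (v ++ u) (θ.pair u.prod v.prod hc) := by
  have e : (fun i => (![u, v] i).prod) = ![u.prod, v.prod] := by
    funext i; fin_cases i <;> rfl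
  have h := hθ.rel_flatten ![u, v] (by intro i; fin_cases i <;> assumption) (Equiv.swap 0 1)
    (by rw [e]; exact swap_mem_permSym hc)
  rw [θ.congr e rfl _ (swap_mem_permSym hc)] at h
  simpa using! h

variable (h1 : ∀ x, θ.pair x x (Commute.refl x) = 1)
include h1

theorem rel_self_unique {w : List G} {c : Fˣ} (h : θ.Rel w w c) : c = 1 := by
  obtain ⟨n, g, σ, hσ, rfl, e, rfl⟩ := h
  exact hθ.eq_one_of_comp_eq h1 σ (List.ofFn_injective e).symm

/-- Two rearrangements with the same source and target words differ by an element of a stabilizer.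
This lets two routes between the same words be compared. -/
theorem rel_unique {w v : List G} {c d : Fˣ} (h : θ.Rel w v c) (h' : θ.Rel w v d) : c = d := by
  have := hθ.rel_self_unique h1 (hθ.rel_trans h (hθ.rel_symm h'))
  rwa [mul_inv_eq_one] at this

/-- The letter g passes the word xy either in one move or by passing x and then y. -/
theorem pair_mul_right (g x y : G) (hx : Commute g x) (hy : Commute g y) :
    θ.pair g (x * y) (hx.mul_right hy) = θ.pair g x hx * θ.pair g y hy := by
  have e1 := hθ.rel_comm (u := [g]) (v := [x, y]) (by simp) (by simp)
    (by simpa using hx.mul_right hy)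
  have e2 := hθ.rel_append [] [y] (hθ.rel_comm (u := [g]) (v := [x]) (by simp) (by simp)
    (by simpa using hx))
  have e3 := hθ.rel_append [x] [] (hθ.rel_comm (u := [g]) (v := [y]) (by simp) (by simp)
    (by simpa using hy))
  have := hθ.rel_unique h1 e1 (hθ.rel_trans e2 e3)
  simpa using this

theorem pair_one_right (g : G) : θ.pair g 1 (Commute.one_right g) = 1 := by
  have := hθ.pair_mul_right h1 g 1 1 (Commute.one_right g) (Commute.one_right g)
  simpa using this

theorem pair_inv_right (g : G) : θ.pair g g⁻¹ (Commute.refl g).inv_right = 1 := by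
  have := hθ.pair_mul_right h1 g g g⁻¹ (Commute.refl g) (Commute.refl g).inv_right
  rw [h1, one_mul] at this
  rw [← this]
  simp [hθ.pair_one_right h1]

/-- Words with product 1 move freely past every word; this makes the quotient monoid below
commutative. -/
theorem rel_comm_of_prod_eq_one (u : List G) {v : List G} (hv : v.prod = 1) :
    θ.Rel (u ++ v) (v ++ u) 1 := by
  by_cases hu' : u = []
  · subst hu'; simpa using hθ.rel_refl v
  by_cases hv' : v = []
  · subst hv'; simpa using hθ.rel_refl u
  have := hθ.rel_comm hu' hv' (by rw [hv]; exact Commute.one_right _)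
  simpa [hv, hθ.pair_one_right h1] using this

theorem rel_inv_comm (p : G) : θ.Rel [p⁻¹, p] [p, p⁻¹] 1 := by
  have := hθ.rel_comm (u := [p]) (v := [p⁻¹]) (by simp) (by simp)
    (by simp)
  have := hθ.rel_symm this
  simpa [hθ.pair_inv_right h1] using this

end IsCommutationFunction

end

/-! ### From trivial diagonal values to a 2-cocycle. -/

section

variable {G F : Type*} [Group G] [Field F] {θ : TupleFunction G F}

/-- An injective homomorphism from a divisible abelian group has a retraction. -/
theorem exists_retraction {K C : Type*} [Field K] [IsAlgClosed K] [CharZero K] [CommGroup C]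
    (i : Kˣ →* C) (hi : Function.Injective i) : ∃ ρ : C →* Kˣ, ∀ c, ρ (i c) = c := by
  -- Roots exist in K, so Kˣ is divisible, hence an injective ℤ-module by Baer's criterion, and the
  -- identity of Kˣ extends along i.
  have hs : ∀ n : ℕ, n ≠ 0 → Function.Surjective fun a : Additive Kˣ => n • a := by
    intro n hn a
    obtain ⟨z, hz⟩ := IsAlgClosed.exists_pow_nat_eq (a.toMul : K) (Nat.pos_of_ne_zero hn)
    have hz0 : z ≠ 0 := by
      rintro rfl
      rw [zero_pow hn] at hz
      exact a.toMul.ne_zero hz.symm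
    exact ⟨Additive.ofMul (Units.mk0 z hz0), Additive.toMul.injective (Units.ext (by simpa using hz))⟩
  let _ : DivisibleBy (Additive Kˣ) ℕ := divisibleByOfSMulRightSurj _ _ (fun {n} hn => hs n hn)
  let _ : DivisibleBy (Additive Kˣ) ℤ := AddGroup.divisibleByIntOfDivisibleByNat _
  obtain ⟨ρ, hρ⟩ := (Module.Baer.of_divisible (Additive Kˣ)).extension_property_addMonoidHom
    (MonoidHom.toAdditive i) hi (AddMonoidHom.id _)
  exact ⟨MonoidHom.toAdditive.symm ρ, fun c => DFunLike.congr_fun hρ (Additive.ofMul c)⟩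

/-- The words with product `1`. -/
abbrev trivialWords (G : Type*) [Group G] : Submonoid (FreeMonoid G) :=
  MonoidHom.mker (FreeMonoid.lift (id : G → G))

theorem mem_trivialWords (w : FreeMonoid G) : w ∈ trivialWords G ↔ w.toList.prod = 1 := by
  rw [MonoidHom.mem_mker, FreeMonoid.lift_apply, List.map_id]

section
variable (hθ : IsCommutationFunction θ)
include hθ

/-- The congruence on scalar multiples of words with product `1` which identifies a word with
the scalar multiple of each of its rearrangements prescribed by `θ`. -/
def IsCommutationFunction.con : Con (Fˣ × trivialWords G) where
  -- A relation with value c reads w = c·v, so a·w is identified with (ac)·v.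
  r x y := ∃ c, θ.Rel x.2.1.toList y.2.1.toList c ∧ y.1 = x.1 * c
  iseqv :=
    { refl := fun x => ⟨1, hθ.rel_refl _, (mul_one _).symm⟩
      symm := fun ⟨c, h, e⟩ => ⟨c⁻¹, hθ.rel_symm h, by rw [e, mul_inv_cancel_right]⟩
      trans := fun ⟨c, h, e⟩ ⟨d, h', e'⟩ => ⟨c * d, hθ.rel_trans h h', by rw [e', e, mul_assoc]⟩ }
  mul' := by
    rintro ⟨a, u⟩ ⟨b, v⟩ ⟨a', u'⟩ ⟨b', v'⟩ ⟨c, h, e⟩ ⟨d, h', e'⟩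
    refine ⟨c * d, hθ.rel_trans (v := v.1.toList ++ u'.1.toList) ?_ ?_, ?_⟩
    · simpa using! hθ.rel_append [] u'.1.toList h
    · simpa using! hθ.rel_append v.1.toList [] h'
    · simp only at e e'
      simp only [Prod.mk_mul_mk, e, e']
      exact mul_mul_mul_comm _ _ _ _

variable (h1 : ∀ x, θ.pair x x (Commute.refl x) = 1)
include h1

/-- The function l is a retraction of the Grothendieck group of the quotient onto Fˣ, evaluated at
classes of words. Being the identity on scalars, it turns the identification w = c·v into l(w) =
c·l(v). -/
theorem IsCommutationFunction.exists_character [IsAlgClosed F] [CharZero F] :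
    ∃ l : List G → Fˣ, (∀ u v, u.prod = 1 → v.prod = 1 → l (u ++ v) = l u * l v) ∧
      ∀ u v c, u.prod = 1 → θ.Rel u v c → l u = c * l v := by
  let _ : CommMonoid hθ.con.Quotient :=
    { (inferInstance : Monoid hθ.con.Quotient) with
      mul_comm := by
        intro x y
        induction x, y using Con.induction_on₂ with
        | _ x y =>
          rw [← Con.coe_mul, ← Con.coe_mul, Con.eq]
          refine ⟨1, hθ.rel_comm_of_prod_eq_one h1 _ ((mem_trivialWords _).1 y.2.2), ?_⟩
          rw [mul_one]; exact mul_comm _ _ }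
  let q : Fˣ × trivialWords G →* Algebra.GrothendieckGroup hθ.con.Quotient :=
    Algebra.GrothendieckGroup.of.comp hθ.con.mk'
  -- If scalars c and d agree in the Grothendieck group, they agree after multiplication by some
  -- class a·w. The word w is then related to itself, which happens only with value 1, so c = d.
  have hq : Function.Injective (q.comp (MonoidHom.inl Fˣ (trivialWords G))) := by
    intro c d h
    obtain ⟨z, hz⟩ := (Localization.monoidOf (⊤ : Submonoid hθ.con.Quotient)).exists_of_eq h
    obtain ⟨⟨a, w⟩, hw⟩ := hθ.con.mk'_surjective z.1
    rw [← hw, ← map_mul, ← map_mul] at hz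
    obtain ⟨r, hr, e⟩ := (Con.eq _).1 hz
    have := hθ.rel_self_unique h1 hr
    subst this
    simpa using e.symm
  obtain ⟨ρ, hρ⟩ := exists_retraction _ hq
  classical
  let l : List G → Fˣ := fun w =>
    if h : w.prod = 1 then ρ (q (1, ⟨FreeMonoid.ofList w, (mem_trivialWords _).2 h⟩)) else 1
  have hl : ∀ w (h : w.prod = 1), l w =
      ρ (q (1, ⟨FreeMonoid.ofList w, (mem_trivialWords _).2 h⟩)) := fun w h => dif_pos h
  refine ⟨l, ?_, ?_⟩
  · intro u v hu hv
    rw [hl u hu, hl v hv, hl _ (by rw [List.prod_append, hu, hv, one_mul]), ← map_mul, ← map_mul]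
    congr 2
    exact Prod.ext (mul_one 1).symm rfl
  · intro u v c hu h
    have hv : v.prod = 1 := by rw [← h.prod_eq, hu]
    rw [hl u hu, hl v hv]
    conv_rhs => rw [← hρ c, ← map_mul, MonoidHom.comp_apply, ← map_mul]
    congr 1
    refine congrArg Algebra.GrothendieckGroup.of ((Con.eq _).2 ⟨c, ?_, ?_⟩)
    · exact h
    · simp

/-- A commutation function with `θ_{g,g} = 1` for all `g` is that of a twisted group algebra. -/
theorem IsCommutationFunction.exists_cocycle [IsAlgClosed F] [CharZero F] :
    ∃ (α : TwoCocycle G F) (f : List G → Fˣ), f [] = (α.toFun 1 1)⁻¹ ∧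
      (∀ g w, f (g :: w) = f w * α.toFun g w.prod) ∧
      ∀ u v c, θ.Rel u v c → f u = c * f v := by
  obtain ⟨l, hmul, hrel⟩ := hθ.exists_character h1
  -- The word is closed up by the inverse of its product; the denominator normalises f to 1 on
  -- one-letter words.
  let f : List G → Fˣ := fun w => l (w ++ [w.prod⁻¹]) / l [w.prod, w.prod⁻¹]
  -- Replacing a subword by its product costs exactly f of the subword. The cocycle identity and the
  -- recursion for f are instances of this.
  have hf : ∀ u w v : List G, f (u ++ w ++ v) = f w * f (u ++ [w.prod] ++ v) := by
    intro u w v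
    set p := w.prod with hp
    have hprod : (u ++ w ++ v).prod = (u ++ [p] ++ v).prod := by simp [hp]
    set q := (u ++ w ++ v).prod with hq
    have hwp : (w ++ [p⁻¹]).prod = 1 := by simp [hp]
    have hpp : [p⁻¹, p].prod = 1 := by simp
    have hpp' : [p, p⁻¹].prod = 1 := by simp
    have hvq : (u ++ w ++ v ++ [q⁻¹]).prod = 1 := by rw [List.prod_append, ← hq]; simp
    have hvq' : (u ++ [p] ++ v ++ [q⁻¹]).prod = 1 := by rw [List.prod_append, ← hprod]; simp
    have key : l (u ++ w ++ v ++ [q⁻¹]) * l [p, p⁻¹] =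
        l (w ++ [p⁻¹]) * l (u ++ [p] ++ v ++ [q⁻¹]) := by
      rw [← hmul _ _ hvq hpp', ← hmul _ _ hwp hvq']
      -- The word u w v q⁻¹ p p⁻¹ is carried to w p⁻¹ u p v q⁻¹ by three moves of value 1: exchange
      -- p and p⁻¹, move p⁻¹ p in front of v q⁻¹, and move w p⁻¹ in front of u.
      have r1 := hθ.rel_append (u ++ w ++ v ++ [q⁻¹]) [] (hθ.rel_symm (hθ.rel_inv_comm h1 p))
      have r2 := hθ.rel_append (u ++ w) [] (hθ.rel_comm_of_prod_eq_one h1 (v ++ [q⁻¹]) hpp)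
      have r3 := hθ.rel_append [] ([p] ++ v ++ [q⁻¹]) (hθ.rel_comm_of_prod_eq_one h1 u hwp)
      simp only [List.append_assoc, List.append_nil, List.nil_append, List.cons_append] at r1 r2 r3
      have r := hθ.rel_trans (hθ.rel_trans r1 r2) r3
      have := hrel _ _ _ (by simpa [hp, mul_assoc] using hvq) r
      simpa using this
    simp only [f, ← hprod, ← hq, ← hp]
    rw [div_mul_div_comm, ← key, mul_comm (l [p, p⁻¹]), mul_div_mul_right_eq_div]
  have hf1 : ∀ g, f [g] = 1 := fun g => by simp [f]
  have hcons : ∀ g w, f (g :: w) = f w * f [g, w.prod] := fun g w => by simpa using hf [g] w []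
  refine ⟨⟨fun g h => f [g, h], ?_⟩, f, ?_, hcons, ?_⟩
  · intro g h k
    -- The word ghk is collapsed from the left and from the right.
    have a := hf [] [g, h] [k]
    have b := hcons g [h, k]
    simp only [List.nil_append, List.cons_append, List.prod_cons, List.prod_nil, mul_one] at a b
    rw [← a, b]
  · have := hcons 1 []
    rw [hf1] at this
    exact eq_inv_of_mul_eq_one_left (by simpa using this.symm)
  · intro u v c h
    have hp := h.prod_eq
    have r := hθ.rel_append [] [v.prod⁻¹] h
    simp only [List.nil_append] at r
    have := hrel _ _ _ (by simp [hp]) r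
    simp only [f, hp, this, mul_div_assoc]

end

end

/-! ### The Grassmann algebra and its commutation function. -/

section

section Grassmann
variable {F : Type*} [Field F]

theorem involute_of_mem_grassmannPart {ε : ℤˣ} {x : Grassmann F} (hx : x ∈ grassmannPart F ε) :
    CliffordAlgebra.involute x = ((ε : ℤ) : F) • x := by
  rcases Int.units_eq_one_or ε with rfl | rfl
  · rw [grassmannPart, if_pos rfl] at hx
    simpa using CliffordAlgebra.involute_eq_of_mem_even hx
  · rw [grassmannPart, if_neg (by decide)] at hx
    simpa using CliffordAlgebra.involute_eq_of_mem_odd hx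

theorem ι_mul_eq_involute_mul (m : ℕ →₀ F) (x : Grassmann F) :
    ExteriorAlgebra.ι F m * x = CliffordAlgebra.involute x * ExteriorAlgebra.ι F m := by
  induction x using CliffordAlgebra.induction with
  | algebraMap r => simp [Algebra.commutes]
  | ι v =>
    have := ExteriorAlgebra.ι_add_mul_swap (R := F) m v
    rw [CliffordAlgebra.involute_ι, neg_mul]
    exact eq_neg_of_add_eq_zero_left this
  | mul a b ha hb => rw [← mul_assoc, ha, mul_assoc, hb, map_mul, mul_assoc]
  | add a b ha hb => rw [mul_add, ha, hb, map_add, add_mul]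

/-- The scalar by which homogeneous elements of `E` of degrees `ε` and `ε'` commute. -/
def parityFactor (F : Type*) [Field F] (ε ε' : ℤˣ) : Fˣ :=
  if ε' = 1 then 1 else if ε = 1 then 1 else -1

/-- By induction from the generators, an even y is central, and an odd y commutes with any z up to
the grading involution of z. -/
theorem grassmann_mul_comm {ε ε' : ℤˣ} {x y : Grassmann F} (hx : x ∈ grassmannPart F ε)
    (hy : y ∈ grassmannPart F ε') : x * y = (parityFactor F ε ε' : F) • (y * x) := by
  have hι := fun m => ι_mul_eq_involute_mul m y
  simp only [involute_of_mem_grassmannPart hy] at hι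
  rcases Int.units_eq_one_or ε' with rfl | rfl
  · have : ∀ z : Grassmann F, z * y = y * z := by
      intro z
      induction z using CliffordAlgebra.induction with
      | algebraMap r => exact Algebra.commutes _ _
      | ι v => simpa using! hι v
      | mul a b ha hb => rw [mul_assoc, hb, ← mul_assoc, ha, mul_assoc]
      | add a b ha hb => rw [mul_add, ← ha, ← hb, add_mul]
    simp [parityFactor, this x]
  · have : ∀ z : Grassmann F, z * y = y * CliffordAlgebra.involute z := by
      intro z
      induction z using CliffordAlgebra.induction with
      | algebraMap r => rw [AlgHom.commutes]; exact Algebra.commutes _ _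
      | ι v =>
        rw [CliffordAlgebra.involute_ι]
        simpa using! hι v
      | mul a b ha hb => rw [mul_assoc, hb, ← mul_assoc, ha, mul_assoc, map_mul]
      | add a b ha hb => rw [map_add, mul_add, ← ha, ← hb, add_mul]
    rw [this x, involute_of_mem_grassmannPart hx, mul_smul_comm]
    rcases Int.units_eq_one_or ε with rfl | rfl <;> simp [parityFactor]

theorem ι_mem_grassmannPart (m : ℕ →₀ F) : ExteriorAlgebra.ι F m ∈ grassmannPart F (-1) := by
  rw [grassmannPart, if_neg (by decide)]
  exact CliffordAlgebra.ι_mem_evenOdd_one _ _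

/-- The generators `e_i` of the Grassmann algebra. -/
def generator (F : Type*) [Field F] (i : ℕ) : Grassmann F :=
  ExteriorAlgebra.ι F (Finsupp.single i 1)

/-- Contraction with the i-th coordinate functional annihilates products not involving e_i and
strips a leading e_i, so a vanishing product could be shortened to the empty one. -/
theorem generator_prod_ne_zero (l : List ℕ) (hl : l.Nodup) :
    (l.map (generator F)).prod ≠ 0 := by
  have hz : ∀ (i : ℕ) (l : List ℕ), i ∉ l → CliffordAlgebra.contractLeft (Q := 0)
      (Finsupp.lapply i : Module.Dual F (ℕ →₀ F)) (l.map (generator F)).prod = 0 := by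
    intro i l
    induction l with
    | nil => intro _; exact CliffordAlgebra.contractLeft_one (Q := (0 : QuadraticForm F (ℕ →₀ F))) _
    | cons j l ih =>
      intro h
      rw [List.map_cons, List.prod_cons]
      refine (CliffordAlgebra.contractLeft_ι_mul (Q := 0)
        (Finsupp.lapply i : Module.Dual F (ℕ →₀ F)) _ _).trans ?_
      rw [ih (fun h' => h (List.mem_cons_of_mem _ h')), Finsupp.lapply_apply,
        Finsupp.single_eq_of_ne (by rintro rfl; simp at h)]
      simp
  induction l with
  | nil => simp
  | cons i l ih =>
    intro h
    rw [List.nodup_cons] at hl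
    rw [List.map_cons, List.prod_cons] at h
    have := (CliffordAlgebra.contractLeft_ι_mul (Q := 0)
      (Finsupp.lapply i : Module.Dual F (ℕ →₀ F)) (Finsupp.single i 1)
      (l.map (generator F)).prod).symm.trans
      (congrArg (CliffordAlgebra.contractLeft (Q := 0)
        (Finsupp.lapply i : Module.Dual F (ℕ →₀ F))) h)
    rw [hz i l hl.1] at this
    exact ih hl.2 (by simpa using this)

/-- Even positions receive 1 and odd position i receives e_i, so the generators used are distinct.
-/
theorem exists_grassmann_prod_ne_zero {n : ℕ} (ε : Fin n → ℤˣ) :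
    ∃ x : Fin n → Grassmann F, (∀ i, x i ∈ grassmannPart F (ε i)) ∧ (List.ofFn x).prod ≠ 0 := by
  refine ⟨fun i => if ε i = 1 then 1 else generator F i, fun i => ?_, ?_⟩
  · change (if ε i = 1 then 1 else generator F i) ∈ _
    rcases Int.units_eq_one_or (ε i) with h | h
    · rw [if_pos h, h]; exact one_mem_grassmannPart F
    · rw [if_neg (by rw [h]; decide), h]; exact ι_mem_grassmannPart _
  · have : ∀ l : List (Fin n), (l.map fun i => if ε i = 1 then 1 else generator F i).prod =
        (((l.filter fun i => ε i ≠ 1).map Fin.val).map (generator F)).prod := by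
      intro l
      induction l with
      | nil => rfl
      | cons i l ih =>
        by_cases h : ε i = 1 <;> simp [h, ih]
    rw [List.ofFn_eq_map, this]
    exact generator_prod_ne_zero _ (((List.nodup_finRange n).filter _).map Fin.val_injective)

theorem prod_mem_grassmannPart {n : ℕ} {ε : Fin n → ℤˣ} {x : Fin n → Grassmann F}
    (hx : ∀ i, x i ∈ grassmannPart F (ε i)) :
    (List.ofFn x).prod ∈ grassmannPart F (List.ofFn ε).prod := by
  induction n with
  | zero => simpa using one_mem_grassmannPart F
  | succ n ih =>
    rw [List.ofFn_succ, List.ofFn_succ, List.prod_cons, List.prod_cons]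
    exact mul_mem_grassmannPart (hx 0) (ih fun i => hx i.succ)

/-- Adjacent transpositions generate the symmetric group, and for these the scalar is
`parityFactor`; the degrees are permuted along when scalars are composed. -/
theorem exists_grassmannSign {n : ℕ} (ε : Fin n → ℤˣ) (σ : Equiv.Perm (Fin n)) :
    ∃ s : Fˣ, ∀ x : Fin n → Grassmann F, (∀ i, x i ∈ grassmannPart F (ε i)) →
      (List.ofFn x).prod = (s : F) • (List.ofFn (x ∘ σ)).prod := by
  obtain _ | n := n
  · exact ⟨1, fun x _ => by simp⟩
  have hσ : σ ∈ Submonoid.closure (Set.range fun i : Fin n => Equiv.swap i.castSucc i.succ) := by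
    rw [Equiv.Perm.mclosure_swap_castSucc_succ]; trivial
  induction hσ using Submonoid.closure_induction generalizing ε with
  | one => exact ⟨1, fun x _ => by simp⟩
  | mul σ τ _ _ hσ hτ =>
    obtain ⟨s, hs⟩ := hσ ε
    obtain ⟨t, ht⟩ := hτ (ε ∘ σ)
    refine ⟨s * t, fun x hx => ?_⟩
    rw [hs x hx, ht (x ∘ σ) (fun i => hx (σ i)), smul_smul, Units.val_mul]
    rfl
  | mem σ h =>
    obtain ⟨i, rfl⟩ := h
    refine ⟨parityFactor F (ε i.castSucc) (ε i.succ), fun x hx => ?_⟩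
    -- There are n + 1 letters: i before the exchanged pair and n - 1 - i after it.
    have hi : (i : ℕ) + 2 + (n - 1 - i) = n + 1 := by omega
    rw [ofFn_eq_append hi x, ofFn_eq_append hi (x ∘ _)]
    have e1 : (fun j : Fin i => (x ∘ Equiv.swap i.castSucc i.succ) ⟨j, by omega⟩) =
        fun j : Fin i => x ⟨j, by omega⟩ := by
      funext j
      rw [Function.comp, Equiv.swap_apply_of_ne_of_ne] <;> simp [Fin.ext_iff] <;> omega
    have e2 : (fun j : Fin (n - 1 - i) => (x ∘ Equiv.swap i.castSucc i.succ)
        ⟨i + 2 + j, by omega⟩) = fun j : Fin (n - 1 - i) => x ⟨i + 2 + j, by omega⟩ := by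
      funext j
      rw [Function.comp, Equiv.swap_apply_of_ne_of_ne] <;> simp [Fin.ext_iff] <;> omega
    have e3 : List.ofFn (fun j : Fin 2 => (x ∘ Equiv.swap i.castSucc i.succ) ⟨i + j, by omega⟩) =
        [x i.succ, x i.castSucc] := by
      have h0 : Equiv.swap i.castSucc i.succ ⟨i, by omega⟩ = i.succ :=
        Equiv.swap_apply_left i.castSucc i.succ
      have h1 : Equiv.swap i.castSucc i.succ ⟨i + 1, by omega⟩ = i.castSucc :=
        Equiv.swap_apply_right i.castSucc i.succ
      simp [List.ofFn_succ, h0, h1]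
    have e4 : List.ofFn (fun j : Fin 2 => x ⟨i + j, by omega⟩) = [x i.castSucc, x i.succ] := by
      simp only [List.ofFn_succ, List.ofFn_zero]; rfl
    rw [e1, e2, e3, e4]
    simp only [List.prod_append, List.prod_cons, List.prod_nil, mul_one]
    rw [grassmann_mul_comm (hx i.castSucc) (hx i.succ)]
    simp only [smul_mul_assoc, mul_smul_comm]

/-- The sign with which homogeneous elements of `E` of degrees `ε 1, …, ε n` are rearranged. -/
def grassmannSign (F : Type*) [Field F] {n : ℕ} (ε : Fin n → ℤˣ) (σ : Equiv.Perm (Fin n)) : Fˣ :=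
  (exists_grassmannSign ε σ).choose

theorem grassmannSign_spec {n : ℕ} {ε : Fin n → ℤˣ} (σ : Equiv.Perm (Fin n))
    {x : Fin n → Grassmann F} (hx : ∀ i, x i ∈ grassmannPart F (ε i)) :
    (List.ofFn x).prod = (grassmannSign F ε σ : F) • (List.ofFn (x ∘ σ)).prod :=
  (exists_grassmannSign ε σ).choose_spec x hx

/-- A single family with nonzero product determines the scalar, so identities between signs can be
tested on one such family. -/
theorem grassmannSign_eq {n : ℕ} {ε : Fin n → ℤˣ} {σ : Equiv.Perm (Fin n)}
    {x : Fin n → Grassmann F} (hx : ∀ i, x i ∈ grassmannPart F (ε i)) (h0 : (List.ofFn x).prod ≠ 0)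
    {s : Fˣ} (hs : (List.ofFn x).prod = (s : F) • (List.ofFn (x ∘ σ)).prod) :
    grassmannSign F ε σ = s := by
  rw [grassmannSign_spec σ hx] at h0
  rw [grassmannSign_spec σ hx] at hs
  exact Units.ext (smul_left_injective F (right_ne_zero_of_smul h0) hs)

theorem grassmannSign_pair (ε : ℤˣ) :
    grassmannSign F ![ε, ε] (Equiv.swap 0 1) = Units.map (Int.castRingHom F : ℤ →* F) ε := by
  obtain ⟨x, hx, h0⟩ := exists_grassmann_prod_ne_zero (F := F) ![ε, ε]
  refine grassmannSign_eq hx h0 ?_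
  have h := grassmann_mul_comm (hx 0) (hx 1)
  have e : (parityFactor F (![ε, ε] 0) (![ε, ε] 1)) = Units.map (Int.castRingHom F : ℤ →* F) ε := by
    rcases Int.units_eq_one_or ε with rfl | rfl
    · simp [parityFactor]
    · ext; simp [parityFactor]
  rw [e] at h
  simpa [List.ofFn_succ] using h

end Grassmann

section
variable {G F : Type*} [Group G] [Field F]

/-- The commutation function of `E` for the degrees `ψ(g) ∈ {±1}`. -/
def signFunction (F : Type*) [Field F] (ψ : G →* ℤˣ) : TupleFunction G F :=
  fun _ g σ _ => grassmannSign F (ψ ∘ g) σ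

/-- Each axiom holds because both sides rearrange one nonzero product in E in the same way. -/
theorem isCommutationFunction_signFunction (ψ : G →* ℤˣ) :
    IsCommutationFunction (signFunction F ψ) where
  restrict := by
    intro n m p hp _ g σ σ' hfix hmid _ _
    obtain ⟨x, hx, h0⟩ := exists_grassmann_prod_ne_zero (F := F) (ψ ∘ g)
    refine grassmannSign_eq hx h0 ?_
    have hn : p + m + (n - p - m) = n := by omega
    rw [ofFn_eq_append hn x, ofFn_eq_append hn (x ∘ σ)]
    have e1 : (fun j : Fin p => (x ∘ σ) ⟨j, by omega⟩) = fun j : Fin p => x ⟨j, by omega⟩ := by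
      funext j
      rw [Function.comp, hfix _ (Or.inl j.2)]
    have e2 : (fun j : Fin (n - p - m) => (x ∘ σ) ⟨p + m + j, by omega⟩) =
        fun j : Fin (n - p - m) => x ⟨p + m + j, by omega⟩ := by
      funext j
      rw [Function.comp, hfix _ (Or.inr (Nat.le_add_right _ _))]
    have e3 : (fun j : Fin m => (x ∘ σ) ⟨p + j, by omega⟩) =
        (fun j : Fin m => x ⟨p + j, by omega⟩) ∘ σ' := by
      funext j
      rw [Function.comp, hmid]; rfl
    rw [e1, e2, e3]
    simp only [List.prod_append]
    rw [grassmannSign_spec (F := F) (ε := ψ ∘ fun k : Fin m => g ⟨p + k, by omega⟩) σ'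
      (x := fun j : Fin m => x ⟨p + j, by omega⟩) (fun j => hx ⟨p + j, by omega⟩)]
    simp only [smul_mul_assoc, mul_smul_comm]
    rfl
  block := by
    intro k h ν _ b hb σ _ _
    obtain ⟨x, hx, h0⟩ := exists_grassmann_prod_ne_zero (F := F) (ψ ∘ concat b)
    let y : ∀ i, Fin (ν i) → Grassmann F := fun i j => x (finSigmaFinEquiv ⟨i, j⟩)
    have hy : x = concat y := by
      funext s
      obtain ⟨s, rfl⟩ := finSigmaFinEquiv.surjective s
      rw [concat_finSigmaFinEquiv]
    refine (grassmannSign_eq hx h0 ?_).symm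
    have hz : ∀ i, (List.ofFn (y i)).prod ∈ grassmannPart F ((ψ ∘ h) i) := by
      intro i
      have := prod_mem_grassmannPart (F := F) (ε := ψ ∘ b i) (x := y i) (fun j => by
        have := hx (finSigmaFinEquiv ⟨i, j⟩)
        rwa [Function.comp, concat_finSigmaFinEquiv] at this)
      rwa [← List.map_ofFn, ← map_list_prod, hb] at this
    have e : ∀ z : ∀ i : Fin k, List (Grassmann F), (List.ofFn z).flatten.prod =
        (List.ofFn fun i => (z i).prod).prod := by
      intro z
      rw [List.prod_flatten, List.map_ofFn]; rfl
    rw [hy, ofFn_concat, ofFn_concat_comp_blockPerm, e, e, grassmannSign_spec σ hz]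
    rfl
  mul := by
    intro n g σ τ _ _ _
    obtain ⟨x, hx, h0⟩ := exists_grassmann_prod_ne_zero (F := F) (ψ ∘ g)
    refine (grassmannSign_eq hx h0 ?_).symm
    rw [grassmannSign_spec σ hx, grassmannSign_spec (F := F) (ε := ψ ∘ g ∘ σ) τ (x := x ∘ σ)
      (fun i => hx (σ i)), smul_smul, Units.val_mul]
    rfl

theorem IsCommutationFunction.div {θ η : TupleFunction G F} (hθ : IsCommutationFunction θ)
    (hη : IsCommutationFunction η) :
    IsCommutationFunction (fun n g σ hσ => θ n g σ hσ / η n g σ hσ : TupleFunction G F) where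
  restrict n m p hp hm g σ σ' h h' hσ hσ' := by
    rw [hθ.restrict n m p hp hm g σ σ' h h' hσ hσ', hη.restrict n m p hp hm g σ σ' h h' hσ hσ']
  block k h ν hν b hb σ hσ hσ' := by
    rw [hθ.block k h ν hν b hb σ hσ hσ', hη.block k h ν hν b hb σ hσ hσ']
  mul n g σ τ hσ hτ hστ := by
    rw [← hθ.mul n g σ τ hσ hτ hστ, ← hη.mul n g σ τ hσ hτ hστ, div_mul_div_comm]

end

end

/-! ### The Grassmann envelope of the twisted group algebra. -/

section

variable {G F : Type*} [Group G] [Field F]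

theorem TwistedGroupAlgebra.list_prod_U {α : TwoCocycle G F} {f : List G → Fˣ}
    (h0 : f [] = (α.toFun 1 1)⁻¹) (hc : ∀ g w, f (g :: w) = f w * α.toFun g w.prod) (w : List G) :
    (w.map (U α)).prod = (f w : F) • U α w.prod := by
  induction w with
  | nil => rw [List.map_nil, List.prod_nil, List.prod_nil, one_def, h0, Units.val_inv_eq_inv_val]
  | cons g w ih =>
    rw [List.map_cons, List.prod_cons, ih, mul_smul_comm, U_mul_U, smul_smul, List.prod_cons, hc,
      Units.val_mul]

variable (α : TwoCocycle G F) (ψ : G →* ℤˣ)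

/-- Since B_g is the line through U_g, every homogeneous element is a pure tensor. -/
theorem mem_twistedEnvelopePart {g : G} {x : twistedEnvelope α ψ} :
    x ∈ twistedEnvelopePart α ψ g ↔
      ∃ u ∈ grassmannPart F (ψ g), TwistedGroupAlgebra.U α g ⊗ₜ[F] u = x.1 := by
  rw [twistedEnvelopePart, Submodule.mem_comap, TwistedGroupAlgebra.component,
    Submodule.map₂_span_singleton_eq_map, Submodule.mem_map]
  rfl

theorem tmul_mem_twistedEnvelope {g : G} {u : Grassmann F} (hu : u ∈ grassmannPart F (ψ g)) :
    TwistedGroupAlgebra.U α g ⊗ₜ[F] u ∈ twistedEnvelope α ψ := by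
  change _ ∈ ⨆ ε : ℤˣ, Submodule.map₂ (TensorProduct.mk F _ (Grassmann F))
    (TwistedGroupAlgebra.cosetPart α ψ.ker ε) (grassmannPart F ε)
  refine Submodule.mem_iSup_of_mem (ψ g) (Submodule.apply_mem_map₂ _ ?_ hu)
  rw [TwistedGroupAlgebra.mem_cosetPart_iff]
  exact Submodule.subset_span ⟨g, rfl, rfl⟩

open Classical in
/-- The coefficient of `U_g` in `B ⊗ E`. -/
def coefficient (g : G) : TwistedGroupAlgebra α ⊗[F] Grassmann F →ₗ[F] Grassmann F :=
  Finsupp.lapply g ∘ₗ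
    (TensorProduct.equivFinsuppOfBasisLeft (TwistedGroupAlgebra.basis α)).toLinearMap

open Classical in
theorem coefficient_tmul (g h : G) (u : Grassmann F) :
    coefficient α g (TwistedGroupAlgebra.U α h ⊗ₜ u) = if h = g then u else 0 := by
  change TensorProduct.equivFinsuppOfBasisLeft (TwistedGroupAlgebra.basis α) _ g = _
  rw [TensorProduct.equivFinsuppOfBasisLeft_apply_tmul_apply, TwistedGroupAlgebra.U,
    Module.Basis.repr_self, Finsupp.single_apply, ite_smul, one_smul, zero_smul]

theorem isGrading_twistedEnvelopePart : IsGrading (twistedEnvelopePart α ψ) where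
  indep := by
    classical
    refine iSupIndep_def.2 fun g => Submodule.disjoint_def.2 fun x hx hx' => ?_
    obtain ⟨u, hu, e⟩ := (mem_twistedEnvelopePart α ψ).1 hx
    have hk : ⨆ h, ⨆ (_ : h ≠ g), twistedEnvelopePart α ψ h ≤
        LinearMap.ker (coefficient α g ∘ₗ (twistedEnvelope α ψ).val.toLinearMap) := by
      refine iSup₂_le fun h hne y hy => ?_
      obtain ⟨v, hv, e'⟩ := (mem_twistedEnvelopePart α ψ).1 hy
      change coefficient α g y.1 = 0
      rw [← e', coefficient_tmul, if_neg hne]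
    have h0 : coefficient α g x.1 = 0 := hk hx'
    rw [← e, coefficient_tmul, if_pos rfl] at h0
    exact Subtype.ext (by rw [← e, h0, TensorProduct.tmul_zero]; rfl)
  iSup_eq_top := by
    rw [eq_top_iff]
    -- The comparison is made inside B ⊗ E, where spanning tensors split into the U_g ⊗ u;
    -- injectivity of the inclusion brings it back to the envelope.
    have key : (⨆ ε : ℤˣ, Submodule.map₂ (TensorProduct.mk F _ (Grassmann F))
        (TwistedGroupAlgebra.cosetPart α ψ.ker ε) (grassmannPart F ε)) ≤
        (⨆ g, twistedEnvelopePart α ψ g).map (twistedEnvelope α ψ).val.toLinearMap := by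
      refine iSup_le fun ε => Submodule.map₂_le.2 fun b hb u hu => ?_
      rw [TwistedGroupAlgebra.mem_cosetPart_iff] at hb
      induction hb using Submodule.span_induction with
      | mem b h =>
        obtain ⟨g, rfl, rfl⟩ := h
        exact ⟨⟨_, tmul_mem_twistedEnvelope α ψ hu⟩, Submodule.mem_iSup_of_mem g
          ((mem_twistedEnvelopePart α ψ).2 ⟨u, hu, rfl⟩), rfl⟩
      | zero => rw [map_zero, LinearMap.zero_apply]; exact zero_mem _
      | add x y _ _ hx hy => rw [map_add, LinearMap.add_apply]; exact add_mem hx hy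
      | smul c x _ hx => rw [map_smul, LinearMap.smul_apply]; exact Submodule.smul_mem _ _ hx
    rintro ⟨x, hx⟩ -
    obtain ⟨y, hy, e⟩ := key hx
    obtain rfl : y = ⟨x, hx⟩ := Subtype.ext e
    exact hy
  one_mem := by
    refine (mem_twistedEnvelopePart α ψ).2 ⟨((α.toFun 1 1)⁻¹ : F) • 1, ?_, ?_⟩
    · rw [map_one]
      exact Submodule.smul_mem _ _ (one_mem_grassmannPart F)
    · rw [TensorProduct.tmul_smul, TensorProduct.smul_tmul', ← TwistedGroupAlgebra.one_def]
      rfl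
  mul_mem := by
    intro g h a b ha hb
    obtain ⟨u, hu, eu⟩ := (mem_twistedEnvelopePart α ψ).1 ha
    obtain ⟨v, hv, ev⟩ := (mem_twistedEnvelopePart α ψ).1 hb
    refine (mem_twistedEnvelopePart α ψ).2 ⟨(α.toFun g h : F) • (u * v), ?_, ?_⟩
    · rw [map_mul]
      exact Submodule.smul_mem _ _ (mul_mem_grassmannPart hu hv)
    · rw [MulMemClass.coe_mul, ← eu, ← ev, Algebra.TensorProduct.tmul_mul_tmul,
        TwistedGroupAlgebra.U_mul_U, TensorProduct.tmul_smul, TensorProduct.smul_tmul']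

theorem list_prod_tmul {n : ℕ} {f : List G → Fˣ} (h0 : f [] = (α.toFun 1 1)⁻¹)
    (hc : ∀ g w, f (g :: w) = f w * α.toFun g w.prod) (g : Fin n → G) (u : Fin n → Grassmann F) :
    (List.ofFn fun i => TwistedGroupAlgebra.U α (g i) ⊗ₜ[F] u i).prod =
      (f (List.ofFn g) : F) • (TwistedGroupAlgebra.U α (List.ofFn g).prod ⊗ₜ[F]
        (List.ofFn u).prod) := by
  have : (List.ofFn fun i => TwistedGroupAlgebra.U α (g i) ⊗ₜ[F] u i).prod =
      ((List.ofFn g).map (TwistedGroupAlgebra.U α)).prod ⊗ₜ[F] (List.ofFn u).prod := by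
    induction n with
    | zero => simp [Algebra.TensorProduct.one_def]
    | succ n ih =>
      simp only [List.ofFn_succ, List.map_cons, List.prod_cons, ih,
        Algebra.TensorProduct.tmul_mul_tmul]
  rw [this, TwistedGroupAlgebra.list_prod_U h0 hc, TensorProduct.smul_tmul']

end

end RegularGrading

end

theorem mainTheorem10 {F : Type*} [Field F] [IsAlgClosed F] [CharZero F]
    {G : Type*} [Group G] (θ : RegularGrading.TupleFunction G F)
    (hθ : RegularGrading.IsCommutationFunction θ) :
    ∃ ψ : G →* ℤˣ,
      (∀ g : G, (θ.pair g g (Commute.refl g) : F) = ((ψ g : ℤ) : F)) ∧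
      ∃ α : RegularGrading.TwoCocycle G F,
        RegularGrading.IsRegularGrading (RegularGrading.twistedEnvelopePart α ψ) θ := by
  open RegularGrading in
  obtain ⟨ψ, hψ⟩ := hθ.exists_sign
  refine ⟨ψ, fun g => by rw [hψ]; rfl, ?_⟩
  -- Dividing out the Grassmann sign makes all diagonal values 1, since θ_{x,x} and the sign for
  -- (x,x) are both ψ(x).
  have hη := hθ.div (isCommutationFunction_signFunction (F := F) ψ)
  obtain ⟨α, f, h0, hc, hf⟩ := hη.exists_cocycle (fun x => by
    change θ.pair x x (Commute.refl x) / grassmannSign F (ψ ∘ ![x, x]) _ = 1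
    have e : ψ ∘ ![x, x] = ![ψ x, ψ x] := by
      funext i; fin_cases i <;> rfl
    rw [e, grassmannSign_pair, hψ, div_self'])
  refine ⟨α, isGrading_twistedEnvelopePart α ψ, ?_, ?_⟩
  · intro n g σ hσ a ha
    choose u hu e using fun i => (mem_twistedEnvelopePart α ψ).1 (ha i)
    have hfg := hf (List.ofFn g) (List.ofFn (g ∘ σ)) _ ⟨n, g, σ, hσ, rfl, rfl, rfl⟩
    have hval : ∀ b : Fin n → twistedEnvelope α ψ,
        ((List.ofFn b).prod : twistedEnvelope α ψ).1 = (List.ofFn fun i => (b i).1).prod := by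
      intro b
      change (twistedEnvelope α ψ).val _ = _
      rw [map_list_prod, List.map_ofFn]; rfl
    apply Subtype.ext
    change ((List.ofFn a).prod : twistedEnvelope α ψ).1 =
      (θ n g σ hσ : F) • ((List.ofFn (a ∘ σ)).prod : twistedEnvelope α ψ).1
    rw [hval, hval]
    simp only [Function.comp, ← e]
    -- The factor B contributes θ divided by the Grassmann sign, the factor E contributes that sign,
    -- and the product of the two is θ.
    rw [list_prod_tmul α h0 hc g u, list_prod_tmul α h0 hc (fun i => g (σ i)) (fun i => u (σ i)),
      grassmannSign_spec (F := F) (ε := ψ ∘ g) σ hu, hσ, hfg, TensorProduct.tmul_smul, smul_smul,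
      smul_smul, ← Units.val_mul, ← Units.val_mul]
    congr 2
    change θ n g σ hσ / grassmannSign F (ψ ∘ g) σ * _ * _ = _
    rw [mul_right_comm, div_mul_cancel]
    rfl
  · intro n g
    obtain ⟨u, hu, hne⟩ := exists_grassmann_prod_ne_zero (F := F) (ψ ∘ g)
    refine ⟨fun i => ⟨_, tmul_mem_twistedEnvelope α ψ (hu i)⟩,
      fun i => (mem_twistedEnvelopePart α ψ).2 ⟨u i, hu i, rfl⟩, fun h => hne ?_⟩
    have h' := congrArg (twistedEnvelope α ψ).val h
    rw [map_list_prod, List.map_ofFn, map_zero] at h'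
    have h'' := (list_prod_tmul α h0 hc g u).symm.trans h'
    rw [smul_eq_zero_iff_right (Units.ne_zero _)] at h''
    -- The coefficient of U at the total degree is the nonzero product chosen in E.
    have := congrArg (coefficient α (List.ofFn g).prod) h''
    classical
    rwa [coefficient_tmul, if_pos rfl, map_zero] at this
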